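/- Let $K=\mathbb{Q}(i)$ and let $L$ be a quadratic extension of $K$. Call a solution $(x,y)\in L^2$ of $x^4+y^4=1$ trivial if $xy=0$ and nontrivial otherwise. (1) If $x^4+y^4=1$ has a nontrivial solution in $L$, then $L=K(\sqrt{-7})$. (2) If $L\neq K(\sqrt{-7})$, then the solutions of $x^4+y^4=1$ in $L$ are exactly the eight trivial ones $(\pm 1,0)$, $(\pm i,0)$, $(0,\pm 1)$, $(0,\pm i)$. (3) If $L=K(\sqrt{-7})$, then the solutions of $x^4+y^4=1$ in $L$ are exactly these eight trivial ones together with the points $$\left(\epsilon_1\,\frac{1+\epsilon_3\sqrt{-7}}{2},\ \epsilon_2\,\frac{1-\epsilon_3\sqrt{-7}}{2}\right),\qquad \epsilon_1,\epsilon_2\in\{1,-1,i,-i\},\quad \epsilon_3\in\{1,-1\}.$$ -/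

import Mathlib

open scoped IntermediateField

/-- The field `ℚ(i)`, as a subfield of `ℂ`. -/
abbrev GaussianField : Type := ℚ⟮Complex.I⟯

/-- The imaginary unit, seen in an extension `L` of `ℚ(i)`. -/
noncomputable def imagUnit (L : Type*) [Field L] [Algebra GaussianField L] : L :=
  algebraMap GaussianField L (IntermediateField.AdjoinSimple.gen ℚ Complex.I)

/-- The solutions in `L` of `x ^ 4 + y ^ 4 = 1`. -/
def quarticSolutions (L : Type*) [Field L] : Set (L × L) :=
  {p | p.1 ^ 4 + p.2 ^ 4 = 1}

/-- The points `(±1, 0)`, `(±i, 0)`, `(0, ±1)`, `(0, ±i)`. -/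
noncomputable def axisPoints (L : Type*) [Field L] [Algebra GaussianField L] : Set (L × L) :=
  {(1, 0), (-1, 0), (imagUnit L, 0), (-imagUnit L, 0),
    (0, 1), (0, -1), (0, imagUnit L), (0, -imagUnit L)}

/-- The points `(ε₁ (1 + ε₃ s) / 2, ε₂ (1 - ε₃ s) / 2)` with `ε₁, ε₂ ∈ {±1, ±i}` and
`ε₃ ∈ {±1}`; here `s` is a square root of `-7` in `L`. -/
noncomputable def sqrtPoints (L : Type*) [Field L] [Algebra GaussianField L] (s : L) :
    Set (L × L) :=
  {p | ∃ e₁ ∈ ({1, -1, imagUnit L, -imagUnit L} : Set L),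
       ∃ e₂ ∈ ({1, -1, imagUnit L, -imagUnit L} : Set L),
       ∃ e₃ ∈ ({1, -1} : Set L),
         p = (e₁ * ((1 + e₃ * s) / 2), e₂ * ((1 - e₃ * s) / 2))}

/-- `L = K(√-7)`: the extension `L` of `K` is generated by a square root of `-7`. -/
def IsAdjoinSqrtNegSeven (K L : Type*) [Field K] [Field L] [Algebra K L] : Prop :=
  ∃ s : L, s ^ 2 = -7 ∧ K⟮s⟯ = ⊤

/-!
Write `K = ℚ(i)`.  The conic `u² + v² = 1` is parametrised by `t = (1 - u) / v`, so a point with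
`x y ≠ 0` of the quartic satisfies `x² = (1 - t²) / (1 + t²)` and `y² = 2t / (1 + t²)`.  Hence `t` is
the abscissa of points of the elliptic curves `Y² = 2t(1 + t²)` and `W² = 2t(1 - t²)`, with
`Y = y(1 + t²)` and `W = x y(1 + t²)`.

Over `K` these curves have rank `0`: their affine points have `t ∈ {0, ±1, ±i}` and `t ∈ {0, ±1}`
respectively.  Both are twists of `y² = x³ - x` by units, and the statement in `ℤ[i]` is about
coprime `p`, `q` with `p q (p² - q²)` a unit times a square; it is proved by infinite descent
(`descent_step`, `mul_eq_zero_or_sq_eq_of_associated_sq`).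

If `t ∈ K`, then `x²` and `y²` lie in `K`, hence so does one of `x`, `y`, `x y`, and the rational
points of the two curves show that the point is trivial.  If `t ∉ K`, let `F` be its minimal
polynomial, which is quadratic.  With `Y = ρ + σt` and `W = ρ' + σ't`, the polynomial `F` divides the
two cubics `2T(1 + T²) - (ρ + σT)²` and `2T(1 - T²) - (ρ' + σ'T)²` over `K`; their third roots are
abscissas of `K`-points, which leaves finitely many pairs of third roots.  The value of `F` at each of
them is the derivative of the cubic there up to a constant, and the two conditions determine `F`
(`coefficients_of_dvd_of_dvd`): it is `T² ± T/2 + 1/2` or `T² ± T + 2`, of discriminant `-7/4` or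
`-7`.  The points of the quartic are then read off from `t`.
-/

namespace GaussianInt

/-! ### Arithmetic of the Gaussian integers modulo `1 + i` and `2` -/

/-- The imaginary unit of `ℤ[i]`. -/
def i : GaussianInt := ⟨0, 1⟩

lemma i_sq : i ^ 2 = -1 := by
  ext <;> simp [i, pow_two]

lemma isUnit_i : IsUnit i :=
  IsUnit.of_mul_eq_one (-i) (by linear_combination -i_sq)

lemma dvd_or_dvd_sub_one (x : GaussianInt) : 1 + i ∣ x ∨ 1 + i ∣ x - 1 := by
  obtain ⟨a, b⟩ := x
  rcases Int.even_or_odd' (a + b) with ⟨k, hk | hk⟩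
  · left
    refine ⟨⟨k, b - k⟩, ?_⟩
    ext
    · simp [i]
      omega
    · simp [i]
  · right
    refine ⟨⟨k, b - k⟩, ?_⟩
    ext
    · simp [i]
      omega
    · simp [i]

lemma not_one_add_i_dvd_one : ¬ 1 + i ∣ 1 := by
  rintro ⟨⟨a, b⟩, h⟩
  have h1 := congrArg Zsqrtd.re h
  have h2 := congrArg Zsqrtd.im h
  simp [i] at h1 h2
  omega

lemma dvd_sub_one_of_not_dvd {x : GaussianInt} (hx : ¬ 1 + i ∣ x) : 1 + i ∣ x - 1 :=
  (dvd_or_dvd_sub_one x).resolve_left hx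

lemma prime_one_add_i : Prime (1 + i) := by
  refine ⟨?_, fun h => not_one_add_i_dvd_one (isUnit_iff_dvd_one.mp h), fun x y h => ?_⟩
  · intro h
    have := congrArg Zsqrtd.re h
    simp [i] at this
  · by_contra! hc
    obtain ⟨a, ha⟩ := dvd_sub_one_of_not_dvd hc.1
    obtain ⟨b, hb⟩ := dvd_sub_one_of_not_dvd hc.2
    obtain ⟨c, hxy⟩ := h
    refine not_one_add_i_dvd_one ⟨c - a * y - b, ?_⟩
    linear_combination -hb - y * ha + hxy

lemma two_eq : (2 : GaussianInt) = -i * (1 + i) ^ 2 := by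
  linear_combination (2 + i) * i_sq

lemma one_add_i_dvd_two : 1 + i ∣ 2 :=
  ⟨1 - i, by linear_combination i_sq⟩

lemma isCoprime_one_add_i {x : GaussianInt} (hx : ¬ 1 + i ∣ x) : IsCoprime x (1 + i) := by
  obtain ⟨y, hy⟩ := dvd_sub_one_of_not_dvd hx
  exact ⟨1, -y, by linear_combination hy⟩

lemma isCoprime_two {x : GaussianInt} (hx : ¬ 1 + i ∣ x) : IsCoprime x 2 := by
  rw [two_eq, isCoprime_mul_unit_left_right isUnit_i.neg]
  exact (isCoprime_one_add_i hx).pow_right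

lemma two_dvd_sq_sub_one {x : GaussianInt} (hx : ¬ 1 + i ∣ x) : 2 ∣ x ^ 2 - 1 := by
  obtain ⟨y, hy⟩ := dvd_sub_one_of_not_dvd hx
  refine ⟨(1 + i) * y + i * y ^ 2, ?_⟩
  linear_combination (x + 1 + (1 + i) * y) * hy + y ^ 2 * i_sq

lemma eq_of_isUnit {δ : GaussianInt} (h : IsUnit δ) :
    δ = 1 ∨ δ = -1 ∨ δ = i ∨ δ = -i := by
  have h1 := (Zsqrtd.norm_eq_one_iff' (by norm_num) δ).mpr h
  obtain ⟨a, b⟩ := δ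
  simp only [Zsqrtd.norm_def] at h1
  have ha : a ≤ 1 := by nlinarith [sq_nonneg b]
  have ha' : -1 ≤ a := by nlinarith [sq_nonneg b]
  have hb : b ≤ 1 := by nlinarith [sq_nonneg a]
  have hb' : -1 ≤ b := by nlinarith [sq_nonneg a]
  interval_cases a <;> interval_cases b <;> simp_all [i, Zsqrtd.ext_iff]

lemma not_two_dvd_i_sub_one : ¬ (2 : GaussianInt) ∣ i - 1 := by
  rintro ⟨⟨a, b⟩, h⟩
  have h1 := congrArg Zsqrtd.re h
  simp [i] at h1
  omega

/-- The units congruent to `1` modulo `2` are `1` and `-1`, which are squares. -/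
lemma eq_one_or_neg_one_of_two_dvd {δ : GaussianInt} (h : IsUnit δ) (h2 : 2 ∣ δ - 1) :
    δ = 1 ∨ δ = -1 := by
  rcases eq_of_isUnit h with rfl | rfl | rfl | rfl
  · simp
  · simp
  · exact absurd h2 not_two_dvd_i_sub_one
  · refine absurd ?_ not_two_dvd_i_sub_one
    obtain ⟨c, hc⟩ := h2
    exact ⟨-c - 1, by linear_combination -hc⟩

lemma exists_sq_of_two_dvd {δ x : GaussianInt} (h : IsUnit δ) (hx : ¬ 1 + i ∣ x)
    (h2 : 2 ∣ δ * x ^ 2 - 1) : ∃ y, δ * x ^ 2 = y ^ 2 := by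
  obtain ⟨k, hk⟩ := two_dvd_sq_sub_one hx
  obtain ⟨l, hl⟩ := h2
  rcases eq_one_or_neg_one_of_two_dvd h ⟨l - δ * k, by linear_combination hl - δ * hk⟩ with
    rfl | rfl
  · exact ⟨x, by ring⟩
  · exact ⟨i * x, by linear_combination -x ^ 2 * i_sq⟩

/-! ### Descent for `p q (p² - q²) = z²` -/

/-- A factor of a square up to a unit, coprime to its cofactor, is a square up to a unit. -/
lemma exists_unit_mul_sq {x y z : GaussianInt} (hc : IsCoprime x y)
    (h : Associated (x * y) (z ^ 2)) : ∃ δ r, IsUnit δ ∧ x = δ * r ^ 2 := by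
  obtain ⟨r, u, hr⟩ := exists_associated_pow_of_associated_pow_mul hc h.symm
  exact ⟨u, r, u.isUnit, by rw [← hr, mul_comm]⟩

lemma associated_of_eq {x y δ : GaussianInt} (hδ : IsUnit δ) (h : x = δ * y) :
    Associated x y := by
  rw [h]
  exact associated_unit_mul_left y δ hδ

/-- The parametrisation of `a² + b² = 2r²`: the numbers `(a ± ib) / (1 + i)` are coprime with
product a unit times `r²`, hence squares `m²`, `n²` up to units. -/
lemma exists_param_of_sq_add_sq {a b r : GaussianInt} (hab : IsCoprime a b)
    (ha : ¬ 1 + i ∣ a) (hb : ¬ 1 + i ∣ b) (hr : ¬ 1 + i ∣ r)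
    (h : a ^ 2 + b ^ 2 = 2 * r ^ 2) :
    ∃ m n δ : GaussianInt, IsUnit δ ∧ IsCoprime m n ∧ ¬ 1 + i ∣ m ∧ ¬ 1 + i ∣ n ∧
      m ^ 4 - n ^ 4 = δ * (a ^ 2 - b ^ 2) := by
  have hI := i_sq
  have hπ := prime_one_add_i.ne_zero
  obtain ⟨a', ha'⟩ := dvd_sub_one_of_not_dvd ha
  obtain ⟨b', hb'⟩ := dvd_sub_one_of_not_dvd hb
  obtain ⟨u, hu⟩ : ∃ u, a + i * b = (1 + i) * u :=
    ⟨1 + a' + i * b', by linear_combination ha' + i * hb'⟩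
  obtain ⟨v, hv⟩ : ∃ v, a - i * b = (1 + i) * v :=
    ⟨u - (1 + i) * b, by linear_combination hu + b * hI⟩
  have huv : u * v = -i * r ^ 2 := by
    apply mul_left_cancel₀ (pow_ne_zero 2 hπ)
    linear_combination (-(a - i * b)) * hu - (1 + i) * u * hv + h
      + (-b ^ 2 + r ^ 2 * (i + 2)) * hI
  have hru : ¬ 1 + i ∣ u * v := by
    rw [huv, neg_mul, dvd_neg, isUnit_i.dvd_mul_left]
    exact fun hd => hr (prime_one_add_i.dvd_of_dvd_pow hd)
  have hu1 : ¬ 1 + i ∣ u := fun hd => hru (hd.mul_right v)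
  have hv1 : ¬ 1 + i ∣ v := fun hd => hru (hd.mul_left u)
  have hcop : IsCoprime u v := by
    obtain ⟨s, t, hst⟩ := hab
    -- Since `(1 - i) a = u + v` and `(1 + i) b = u - v`, the ideal `(u, v)` contains `1 + i`.
    have hπuv : u * (i * s + t) + v * (i * s - t) = 1 + i := by
      apply mul_left_cancel₀ hπ
      linear_combination -(i * s + t) * hu - (i * s - t) * hv + 2 * i * hst - hI
    have h1 : IsCoprime u (v * (i * s - t) + u * (i * s + t)) := by
      rw [add_comm, hπuv]
      exact isCoprime_one_add_i hu1
    exact (IsCoprime.of_add_mul_left_right h1).of_mul_right_left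
  have has : Associated (u * v) (r ^ 2) := associated_of_eq isUnit_i.neg huv
  obtain ⟨η, m, hη, hm⟩ := exists_unit_mul_sq hcop has
  obtain ⟨θ, n, hθ, hn⟩ := exists_unit_mul_sq hcop.symm (by rwa [mul_comm])
  have hm1 : ¬ 1 + i ∣ m := fun hd => hu1 (hm ▸ (hd.pow two_ne_zero).mul_left η)
  have hn1 : ¬ 1 + i ∣ n := fun hd => hv1 (hn ▸ (hd.pow two_ne_zero).mul_left θ)
  have hmn : IsCoprime m n := by
    rw [hm, hn, isCoprime_mul_unit_left_left hη, isCoprime_mul_unit_left_right hθ] at hcop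
    exact IsCoprime.pow_iff two_pos two_pos |>.mp hcop
  -- Modulo `2` all the squares are `1`, so `η θ ≡ i`.
  have hηθ : 2 ∣ i * (η * θ) - 1 := by
    obtain ⟨c, hc⟩ := two_dvd_sq_sub_one hm1
    obtain ⟨d, hd⟩ := two_dvd_sq_sub_one hn1
    obtain ⟨e, he⟩ := two_dvd_sq_sub_one hr
    have : i * (η * θ) * (m ^ 2 * n ^ 2) = r ^ 2 := by
      linear_combination i * huv - i * v * hm - i * η * m ^ 2 * hn - r ^ 2 * hI
    refine ⟨e - i * (η * θ) * (c + d * m ^ 2), ?_⟩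
    linear_combination this + he - i * η * θ * hc - i * η * θ * m ^ 2 * hd
  have hθη : θ ^ 2 = -η ^ 2 ∧ IsUnit (η ^ 2) ∧ (η ^ 2) ^ 2 = 1 := by
    have h4 : (η ^ 2) ^ 2 = 1 := by
      rcases eq_of_isUnit hη with rfl | rfl | rfl | rfl
      · ring
      · ring
      · rw [hI]; ring
      · rw [neg_sq, hI]; ring
    have h5 : (i * (η * θ)) ^ 2 = 1 := by
      rcases eq_one_or_neg_one_of_two_dvd (isUnit_i.mul (hη.mul hθ)) hηθ with h | h <;>
        rw [h] <;> ring
    refine ⟨?_, hη.pow 2, h4⟩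
    linear_combination -η ^ 2 * h5 + η ^ 4 * θ ^ 2 * hI - θ ^ 2 * h4
  obtain ⟨h1, h2, h3⟩ := hθη
  refine ⟨m, n, -i * η ^ 2, isUnit_i.neg.mul h2, hmn, hm1, hn1, ?_⟩
  have h4 : u ^ 2 + v ^ 2 = η ^ 2 * (m ^ 4 - n ^ 4) := by
    rw [hm, hn]
    linear_combination n ^ 4 * h1
  have h5 : a ^ 2 - b ^ 2 = i * (u ^ 2 + v ^ 2) := by
    apply mul_left_cancel₀ (two_ne_zero (α := GaussianInt))
    linear_combination (a + i * b + (1 + i) * u) * hu + (a - i * b + (1 + i) * v) * hv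
      + (u ^ 2 + v ^ 2 - 2 * b ^ 2) * hI
  rw [h5, h4]
  linear_combination -(m ^ 4 - n ^ 4) * h3 + η ^ 4 * (m ^ 4 - n ^ 4) * hI

lemma isCoprime_left_sq_sub_sq {p q : GaussianInt} (h : IsCoprime p q) :
    IsCoprime p (p ^ 2 - q ^ 2) := by
  have h1 := (h.pow_right (n := 2)).neg_right.add_mul_left_right p
  rwa [show -q ^ 2 + p * p = p ^ 2 - q ^ 2 by ring] at h1

lemma isCoprime_right_sq_sub_sq {p q : GaussianInt} (h : IsCoprime p q) :
    IsCoprime q (p ^ 2 - q ^ 2) := by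
  rw [← neg_sub, IsCoprime.neg_right_iff]
  exact isCoprime_left_sq_sub_sq h.symm

lemma isCoprime_add_sub {p q : GaussianInt} (h : IsCoprime p q) (hadd : ¬ 1 + i ∣ p + q) :
    IsCoprime (p + q) (p - q) := by
  have h1 : IsCoprime (p + q) p := by
    have := (h.add_mul_left_right 1).symm
    rwa [mul_one, add_comm] at this
  have h2 := ((isCoprime_two hadd).mul_right h1).add_mul_left_right (-1)
  rwa [show 2 * p + (p + q) * -1 = p - q by ring] at h2

/-- The descent: with `q` even, the four coprime factors of `p q (p + q) (p - q)` are units times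
squares, say `a²`, `b²` for `p ± q` after scaling, so that `a² + b² = 2p` is twice a square.  The
parametrisation of this equation yields the pair `((m² + n²) / 2, (m² - n²) / 2)`, of product a
unit times `q / 2`. -/
lemma descent_step {p q z : GaussianInt} (hpq : IsCoprime p q) (hq : 1 + i ∣ q)
    (h0 : p * q ≠ 0) (hz : Associated (p * q * (p ^ 2 - q ^ 2)) (z ^ 2)) :
    ∃ p' q' z' : GaussianInt, IsCoprime p' q' ∧ 1 + i ∣ p' * q' ∧ p' * q' ≠ 0 ∧
      Associated (p' * q' * (p' ^ 2 - q' ^ 2)) (z' ^ 2) ∧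
      (p' * q').norm < (p * q).norm := by
  have hI := i_sq
  have hp : ¬ 1 + i ∣ p := fun hd =>
    prime_one_add_i.not_isUnit (hpq.isUnit_of_dvd' hd hq)
  have hadd : ¬ 1 + i ∣ p + q := fun hd => hp ((dvd_add_left hq).mp hd)
  have hsub : ¬ 1 + i ∣ p - q := fun hd => hp ((dvd_sub_left hq).mp hd)
  have hP := isCoprime_left_sq_sub_sq hpq
  have hQ := isCoprime_right_sq_sub_sq hpq
  have hAS := isCoprime_add_sub hpq hadd
  have hfac : p ^ 2 - q ^ 2 = (p + q) * (p - q) := by ring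
  have hP' := hP
  have hQ' := hQ
  rw [hfac] at hP' hQ'
  obtain ⟨ε, r, hε, hr⟩ := exists_unit_mul_sq (hpq.mul_right hP) (z := z) (by rwa [← mul_assoc])
  obtain ⟨δ, s, hδ, hs⟩ := exists_unit_mul_sq (hpq.symm.mul_right hQ) (z := z)
    (by rwa [← mul_assoc, mul_comm q p])
  obtain ⟨ε₂, a₀, hε₂, ha₀⟩ := exists_unit_mul_sq (z := z)
    ((hP'.of_mul_right_left.symm.mul_right hQ'.of_mul_right_left.symm).mul_right hAS)
    (by rwa [show (p + q) * (p * q * (p - q)) = p * q * (p ^ 2 - q ^ 2) by ring])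
  obtain ⟨ε₃, b₀, hε₃, hb₀⟩ := exists_unit_mul_sq (z := z)
    ((hP'.of_mul_right_right.symm.mul_right hQ'.of_mul_right_right.symm).mul_right hAS.symm)
    (by rwa [show (p - q) * (p * q * (p + q)) = p * q * (p ^ 2 - q ^ 2) by ring])
  obtain ⟨ε', hε'⟩ := isUnit_iff_exists_inv'.mp hε
  have hε'u : IsUnit ε' := IsUnit.of_mul_eq_one ε hε'
  have hr1 : ¬ 1 + i ∣ r := fun hd => hp (hr ▸ (hd.pow two_ne_zero).mul_left ε)
  have ha1 : ¬ 1 + i ∣ a₀ := fun hd => hadd (ha₀ ▸ (hd.pow two_ne_zero).mul_left ε₂)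
  have hb1 : ¬ 1 + i ∣ b₀ := fun hd => hsub (hb₀ ▸ (hd.pow two_ne_zero).mul_left ε₃)
  obtain ⟨s', hs'⟩ : 1 + i ∣ s := by
    rw [hs, hδ.dvd_mul_left] at hq
    exact prime_one_add_i.dvd_of_dvd_pow hq
  have hq2 : q = 2 * (i * δ * s' ^ 2) := by
    rw [hs, hs']
    linear_combination δ * s' ^ 2 * hI
  obtain ⟨k, hk⟩ := two_dvd_sq_sub_one hr1
  obtain ⟨a, ha⟩ := exists_sq_of_two_dvd (hε'u.mul hε₂) ha1
    ⟨k + ε' * (i * δ * s' ^ 2), by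
      linear_combination -ε' * ha₀ + ε' * hr + r ^ 2 * hε' + hk + ε' * hq2⟩
  obtain ⟨b, hb⟩ := exists_sq_of_two_dvd (hε'u.mul hε₃) hb1
    ⟨k - ε' * (i * δ * s' ^ 2), by
      linear_combination -ε' * hb₀ + ε' * hr + r ^ 2 * hε' + hk - ε' * hq2⟩
  have ha2 : a ^ 2 = r ^ 2 + ε' * q := by
    linear_combination -ha - ε' * ha₀ + ε' * hr + r ^ 2 * hε'
  have hb2 : b ^ 2 = r ^ 2 - ε' * q := by
    linear_combination -hb - ε' * hb₀ + ε' * hr + r ^ 2 * hε'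
  have hab : IsCoprime a b := by
    rw [← IsCoprime.pow_iff two_pos two_pos, ← ha, ← hb, mul_assoc, mul_assoc, ← ha₀, ← hb₀,
      isCoprime_mul_unit_left hε'u]
    exact hAS
  have ha3 : ¬ 1 + i ∣ a := by
    intro hd
    have := hd.pow two_ne_zero
    rw [← ha, (hε'u.mul hε₂).dvd_mul_left] at this
    exact ha1 (prime_one_add_i.dvd_of_dvd_pow this)
  have hb3 : ¬ 1 + i ∣ b := by
    intro hd
    have := hd.pow two_ne_zero
    rw [← hb, (hε'u.mul hε₃).dvd_mul_left] at this
    exact hb1 (prime_one_add_i.dvd_of_dvd_pow this)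
  obtain ⟨m, n, θ, hθ, hmn, hm, hn, h4⟩ := exists_param_of_sq_add_sq hab ha3 hb3 hr1
    (by linear_combination ha2 + hb2)
  obtain ⟨m', hm'⟩ := two_dvd_sq_sub_one hm
  obtain ⟨n', hn'⟩ := two_dvd_sq_sub_one hn
  obtain ⟨P, hPdef⟩ : ∃ P, P = m' + n' + 1 := ⟨_, rfl⟩
  obtain ⟨Q, hQdef⟩ : ∃ Q, Q = m' - n' := ⟨_, rfl⟩
  have hadd' : P + Q = m ^ 2 := by
    linear_combination hPdef + hQdef - hm'
  have hsub' : P - Q = n ^ 2 := by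
    linear_combination hPdef - hQdef - hn'
  have hPQ2 : 2 * (P * Q) = θ * ε' * q := by
    apply mul_left_cancel₀ (two_ne_zero (α := GaussianInt))
    linear_combination (P + Q + m ^ 2) * hadd' - (P - Q + n ^ 2) * hsub' + h4 + θ * ha2 - θ * hb2
  have hPQ : P * Q = θ * ε' * i * δ * s' ^ 2 := by
    apply mul_left_cancel₀ (two_ne_zero (α := GaussianInt))
    linear_combination hPQ2 + θ * ε' * hq2
  have hq0 : q ≠ 0 := right_ne_zero_of_mul h0
  refine ⟨P, Q, s' * m * n, ?_, ?_, ?_, ?_, ?_⟩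
  · obtain ⟨x, y, hxy⟩ := IsCoprime.pow_iff (m := 2) (n := 2) two_pos two_pos |>.mpr hmn
    exact ⟨x + y, x - y, by linear_combination hxy + x * hadd' + y * hsub'⟩
  · by_contra hd
    obtain ⟨x, hx⟩ := dvd_sub_one_of_not_dvd fun hd' => hd (hd'.mul_right Q)
    obtain ⟨y, hy⟩ := dvd_sub_one_of_not_dvd fun hd' => hd (hd'.mul_left P)
    refine hm (prime_one_add_i.dvd_of_dvd_pow (n := 2) ⟨x + y + (1 - i), ?_⟩)
    linear_combination hx + hy - hadd' + hI
  · intro hzero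
    rw [hzero, mul_zero, eq_comm, (hθ.mul hε'u).mul_right_eq_zero] at hPQ2
    exact hq0 hPQ2
  · refine associated_of_eq (((hθ.mul hε'u).mul isUnit_i).mul hδ) ?_
    rw [show P ^ 2 - Q ^ 2 = m ^ 2 * n ^ 2 by rw [← hadd', ← hsub']; ring, hPQ]
    ring
  · have hN := congrArg Zsqrtd.norm hPQ2
    rw [Zsqrtd.norm_mul, Zsqrtd.norm_mul (θ * ε'),
      (Zsqrtd.norm_eq_one_iff' (by norm_num) _).mpr (hθ.mul hε'u), one_mul] at hN
    have h2 : (2 : GaussianInt).norm = 4 := by decide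
    rw [h2] at hN
    rw [Zsqrtd.norm_mul p q]
    have hp1 : 0 < p.norm := norm_pos.mpr (left_ne_zero_of_mul h0)
    have hq1 : 0 < q.norm := norm_pos.mpr hq0
    nlinarith

theorem mul_eq_zero_of_associated_sq_of_even {p q z : GaussianInt} (hpq : IsCoprime p q)
    (heven : 1 + i ∣ p * q) (hz : Associated (p * q * (p ^ 2 - q ^ 2)) (z ^ 2)) :
    p * q = 0 := by
  induction hN : (p * q).norm.natAbs using Nat.strong_induction_on generalizing p q z with
  | _ N ih =>
    by_contra h0
    obtain ⟨p', q', z', h1, h2, h3, h4, h5⟩ : ∃ p' q' z' : GaussianInt, IsCoprime p' q' ∧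
        1 + i ∣ p' * q' ∧ p' * q' ≠ 0 ∧ Associated (p' * q' * (p' ^ 2 - q' ^ 2)) (z' ^ 2) ∧
        (p' * q').norm < (p * q).norm := by
      rcases prime_one_add_i.dvd_or_dvd heven with hp | hq
      · rw [mul_comm p q] at h0 ⊢
        refine descent_step hpq.symm hp h0 (z := z) ?_
        rw [← Associated.neg_left_iff]
        rwa [show -(q * p * (q ^ 2 - p ^ 2)) = p * q * (p ^ 2 - q ^ 2) by ring]
      · exact descent_step hpq hq h0 hz
    refine h3 (ih _ ?_ h1 h2 h4 rfl)
    have := norm_nonneg (p' * q')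
    omega

/-- If `p`, `q` are odd and congruent modulo `2`, the pair `((p + q) / 2, (p - q) / 2)` has one
even member, and its product is a square up to a unit too. -/
theorem sq_eq_sq_of_associated_sq {p q z : GaussianInt} (hpq : IsCoprime p q)
    (hp : ¬ 1 + i ∣ p) (hq : 2 ∣ p - q)
    (hz : Associated (p * q * (p ^ 2 - q ^ 2)) (z ^ 2)) : p ^ 2 = q ^ 2 := by
  obtain ⟨k, hk⟩ := hq
  obtain ⟨w, rfl⟩ : 2 ∣ z := by
    rw [← IsIntegrallyClosed.pow_dvd_pow_iff two_ne_zero]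
    refine (Dvd.intro ((q + k) * k * p * q) ?_ : (2 : GaussianInt) ^ 2 ∣ _).trans hz.dvd
    linear_combination -(2 * k * p * q + p * q * (p + q)) * hk
  have h1 : (q + k) * k = 0 := by
    refine mul_eq_zero_of_associated_sq_of_even (z := w) ?_ ?_ ?_
    · obtain ⟨x, y, hxy⟩ := hpq
      exact ⟨x + y, x - y, by linear_combination hxy - x * hk⟩
    · by_contra hd
      obtain ⟨x, hx⟩ := dvd_sub_one_of_not_dvd fun hd' => hd (hd'.mul_right k)
      obtain ⟨y, hy⟩ := dvd_sub_one_of_not_dvd fun hd' => hd (hd'.mul_left (q + k))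
      exact hp ⟨x + y + (1 - i), by linear_combination hx + hy + hk + i_sq⟩
    · obtain ⟨u, hu⟩ := hz
      refine ⟨u, mul_left_cancel₀ (pow_ne_zero 2 (two_ne_zero (α := GaussianInt))) ?_⟩
      obtain rfl : p = q + 2 * k := by linear_combination hk
      linear_combination hu
  rcases mul_eq_zero.mp h1 with h | h
  · linear_combination (p - q) * hk + 2 * (p - q) * h
  · linear_combination (p + q) * hk + 2 * (p + q) * h

/-- For odd coprime `x`, `y`, if `x⁴ + y⁴` is a square up to a unit, then `x⁴ + y⁴ = 2t²`, so
`t⁴ - (x y)⁴ = ((x⁴ - y⁴) / 2)²`, and `sq_eq_sq_of_associated_sq` applies to `t²`, `(x y)²`. -/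
lemma pow_four_eq_of_add_eq {x y w : GaussianInt} (hxy : IsCoprime x y)
    (hx : ¬ 1 + i ∣ x) (hy : ¬ 1 + i ∣ y) (h : Associated (x ^ 4 + y ^ 4) (w ^ 2)) :
    x ^ 4 = y ^ 4 := by
  have hI := i_sq
  have hprime := prime_one_add_i
  obtain ⟨a, ha⟩ := two_dvd_sq_sub_one hx
  obtain ⟨b, hb⟩ := two_dvd_sq_sub_one hy
  have hx4 : x ^ 4 = 1 + 4 * (a + a ^ 2) := by linear_combination (x ^ 2 + 1 + 2 * a) * ha
  have hy4 : y ^ 4 = 1 + 4 * (b + b ^ 2) := by linear_combination (y ^ 2 + 1 + 2 * b) * hb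
  obtain ⟨u, hu⟩ := h.symm
  obtain ⟨v, rfl⟩ : 1 + i ∣ w := by
    refine hprime.dvd_of_dvd_pow (n := 2) (dvd_trans ?_ h.dvd)
    refine one_add_i_dvd_two.trans ⟨1 + 2 * (a + a ^ 2) + 2 * (b + b ^ 2), ?_⟩
    linear_combination hx4 + hy4
  have h2 : i * u * v ^ 2 = 1 + 2 * (a + a ^ 2) + 2 * (b + b ^ 2) := by
    apply mul_left_cancel₀ (two_ne_zero (α := GaussianInt))
    linear_combination hu + hx4 + hy4 - u * v ^ 2 * hI
  have hv : ¬ 1 + i ∣ v := by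
    intro hd
    have h3 : 1 + i ∣ 1 + 2 * (a + a ^ 2 + b + b ^ 2) := by
      rw [show 1 + 2 * (a + a ^ 2 + b + b ^ 2) = i * u * v ^ 2 by rw [h2]; ring]
      exact (hd.pow two_ne_zero).mul_left _
    exact not_one_add_i_dvd_one ((dvd_add_left (one_add_i_dvd_two.mul_right _)).mp h3)
  obtain ⟨t, ht⟩ := exists_sq_of_two_dvd (isUnit_i.mul u.isUnit) hv
    ⟨a + a ^ 2 + b + b ^ 2, by linear_combination h2⟩
  have hsum : x ^ 4 + y ^ 4 = 2 * t ^ 2 := by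
    linear_combination hx4 + hy4 + 2 * ht - 2 * h2
  obtain ⟨c, hc⟩ : ∃ c, c = 2 * (a + a ^ 2) - 2 * (b + b ^ 2) := ⟨_, rfl⟩
  have hcop : IsCoprime t (x * y) := by
    have h1 : IsCoprime (x ^ 4 + y ^ 4) (x * y) := by
      refine IsCoprime.mul_right ?_ ?_
      · have := (hxy.symm.pow_left (m := 4)).add_mul_left_left (x ^ 3)
        rwa [show y ^ 4 + x * x ^ 3 = x ^ 4 + y ^ 4 by ring] at this
      · have := (hxy.pow_left (m := 4)).add_mul_left_left (y ^ 3)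
        rwa [show x ^ 4 + y * y ^ 3 = x ^ 4 + y ^ 4 by ring] at this
    rw [hsum] at h1
    exact (IsCoprime.pow_left_iff two_pos).mp h1.of_mul_left_right
  have ht1 : ¬ 1 + i ∣ t := by
    intro hd
    have := hd.pow two_ne_zero
    rw [← ht, (isUnit_i.mul u.isUnit).dvd_mul_left] at this
    exact hv (hprime.dvd_of_dvd_pow this)
  have hxy1 : ¬ 1 + i ∣ x * y := fun hd => (hprime.dvd_or_dvd hd).elim hx hy
  -- `t⁴ - (x y)⁴` is the square of `(x⁴ - y⁴) / 2`.
  have key : (t ^ 2) ^ 2 = ((x * y) ^ 2) ^ 2 := by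
    refine sq_eq_sq_of_associated_sq (z := t * (x * y) * c) (hcop.pow) ?_ ?_ ?_
    · exact fun hd => ht1 (hprime.dvd_of_dvd_pow hd)
    · obtain ⟨d, hd⟩ := two_dvd_sq_sub_one ht1
      obtain ⟨e, he⟩ := two_dvd_sq_sub_one hxy1
      exact ⟨d - e, by linear_combination hd - he⟩
    · refine Associated.of_eq ?_
      have hc2 : x ^ 4 - y ^ 4 = 2 * c := by linear_combination hx4 - hy4 - 2 * hc
      have h5 : (t ^ 2) ^ 2 - ((x * y) ^ 2) ^ 2 = c ^ 2 := by
        apply mul_left_cancel₀ (pow_ne_zero 2 (two_ne_zero (α := GaussianInt)))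
        linear_combination (-(x ^ 4 + y ^ 4 + 2 * t ^ 2)) * hsum + (x ^ 4 - y ^ 4 + 2 * c) * hc2
      rw [h5]
      ring
  have h6 : (x ^ 4 - y ^ 4) ^ 2 = 0 := by
    linear_combination 4 * key + (x ^ 4 + y ^ 4 + 2 * t ^ 2) * hsum
  exact sub_eq_zero.mp (pow_eq_zero_iff two_ne_zero |>.mp h6)

/-- The points of `y² = x³ - x`, and of its twist by a unit, over `ℚ(i)`, in homogeneous form.  If
`p`, `q` are odd and incongruent modulo `2`, then `p² - q²` is a unit times `r⁴ + s⁴`. -/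
theorem mul_eq_zero_or_sq_eq_of_associated_sq {p q z : GaussianInt} (hpq : IsCoprime p q)
    (hz : Associated (p * q * (p ^ 2 - q ^ 2)) (z ^ 2)) :
    p * q = 0 ∨ p ^ 2 = q ^ 2 ∨ p ^ 2 = -q ^ 2 := by
  by_cases heven : 1 + i ∣ p * q
  · exact Or.inl (mul_eq_zero_of_associated_sq_of_even hpq heven hz)
  right
  have hI := i_sq
  have hp : ¬ 1 + i ∣ p := fun hd => heven (hd.mul_right q)
  have hq : ¬ 1 + i ∣ q := fun hd => heven (hd.mul_left p)
  have hP := isCoprime_left_sq_sub_sq hpq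
  have hQ := isCoprime_right_sq_sub_sq hpq
  obtain ⟨ε, r, hε, hr⟩ := exists_unit_mul_sq (hpq.mul_right hP) (z := z) (by rwa [← mul_assoc])
  obtain ⟨δ, s, hδ, hs⟩ := exists_unit_mul_sq (hpq.symm.mul_right hQ) (z := z)
    (by rwa [← mul_assoc, mul_comm q p])
  obtain ⟨θ, w, hθ, hw⟩ := exists_unit_mul_sq (hP.symm.mul_right hQ.symm) (z := z)
    (by rwa [mul_comm])
  have hr1 : ¬ 1 + i ∣ r := fun hd => hp (hr ▸ (hd.pow two_ne_zero).mul_left ε)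
  have hs1 : ¬ 1 + i ∣ s := fun hd => hq (hs ▸ (hd.pow two_ne_zero).mul_left δ)
  by_cases h2 : 2 ∣ p - q
  · exact Or.inl (sq_eq_sq_of_associated_sq hpq hp h2 hz)
  right
  obtain ⟨a, ha⟩ := two_dvd_sq_sub_one hr1
  obtain ⟨b, hb⟩ := two_dvd_sq_sub_one hs1
  have hεδ : δ ^ 2 = -ε ^ 2 ∧ IsUnit (ε ^ 2) := by
    refine ⟨?_, hε.pow 2⟩
    have hne : ¬ 2 ∣ ε - δ := by
      rintro ⟨c, hc⟩
      exact h2 ⟨c + ε * a - δ * b, by linear_combination hr - hs + hc + ε * ha - δ * hb⟩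
    rcases eq_of_isUnit hε with rfl | rfl | rfl | rfl <;>
    rcases eq_of_isUnit hδ with rfl | rfl | rfl | rfl <;>
    first
      | linear_combination hI
      | linear_combination -hI
      | exact absurd ⟨0, by ring1⟩ hne
      | exact absurd ⟨1, by ring1⟩ hne
      | exact absurd ⟨-1, by ring1⟩ hne
      | exact absurd ⟨i, by ring1⟩ hne
      | exact absurd ⟨-i, by ring1⟩ hne
  have hrs : IsCoprime r s := by
    rw [hr, hs, isCoprime_mul_unit_left_left hε, isCoprime_mul_unit_left_right hδ] at hpq
    exact IsCoprime.pow_iff two_pos two_pos |>.mp hpq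
  have h4 : p ^ 2 - q ^ 2 = ε ^ 2 * (r ^ 4 + s ^ 4) := by
    rw [hr, hs]
    linear_combination -s ^ 4 * hεδ.1
  have h5 : Associated (r ^ 4 + s ^ 4) (w ^ 2) :=
    (associated_of_eq hεδ.2 h4).symm.trans (associated_of_eq hθ hw)
  have h6 := pow_four_eq_of_add_eq hrs hr1 hs1 h5
  rw [hr, hs]
  linear_combination ε ^ 2 * h6 + s ^ 4 * hεδ.1

/-! ### Two elliptic curves over `ℚ(i)` -/

lemma algebraMap_i_sq {K : Type*} [Field K] [Algebra GaussianInt K] :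
    algebraMap GaussianInt K i ^ 2 = -1 := by
  rw [← map_pow, i_sq, map_neg, map_one]

section FractionField

variable {K : Type*} [Field K] [Algebra GaussianInt K] [IsFractionRing GaussianInt K]

lemma exists_algebraMap_eq_of_sq_eq {z : K} {w : GaussianInt} (h : z ^ 2 = algebraMap _ K w) :
    ∃ v : GaussianInt, algebraMap _ K v = z :=
  IsIntegrallyClosed.exists_algebraMap_eq_of_isIntegral_pow two_pos (h ▸ isIntegral_algebraMap)

/-- The affine points of `y² = x³ - x` and of its twist by a unit, over `ℚ(i)`. -/
theorem eq_zero_or_sq_eq_of_mul_sq_eq {u y : K} {δ : GaussianInt} (hδ : IsUnit δ)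
    (h : u * (u ^ 2 - 1) = algebraMap _ K δ * y ^ 2) : u = 0 ∨ u ^ 2 = 1 ∨ u ^ 2 = -1 := by
  obtain ⟨p, q, hpq, rfl⟩ := IsFractionRing.exists_reduced_fraction (A := GaussianInt) u
  have hinj := IsFractionRing.injective GaussianInt K
  have hq : algebraMap GaussianInt K q ≠ 0 :=
    (map_ne_zero_iff _ hinj).mpr (nonZeroDivisors.ne_zero q.2)
  rw [isRelPrime_iff_isCoprime] at hpq
  rw [IsFractionRing.mk'_eq_div] at h ⊢
  obtain ⟨ε, hε⟩ := isUnit_iff_exists_inv'.mp hδ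
  have hε' := congrArg (algebraMap GaussianInt K) hε
  simp only [map_mul, map_one] at hε'
  have hy : (y * algebraMap _ K (q : GaussianInt) ^ 2) ^ 2 =
      algebraMap _ K (ε * (p * q * (p ^ 2 - q ^ 2))) := by
    simp only [map_mul, map_sub, map_pow]
    field_simp at h
    linear_combination (-algebraMap _ K ε * algebraMap _ K (q : GaussianInt)) * h
      - y ^ 2 * algebraMap _ K (q : GaussianInt) ^ 4 * hε'
  obtain ⟨z, hz⟩ := exists_algebraMap_eq_of_sq_eq hy
  rw [← hz, ← map_pow] at hy
  have hz2 := hinj hy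
  have has : Associated (p * q * (p ^ 2 - q ^ 2)) (z ^ 2) :=
    (associated_of_eq (IsUnit.of_mul_eq_one δ hε) hz2).symm
  rcases mul_eq_zero_or_sq_eq_of_associated_sq hpq has with h0 | h1 | h2
  · left
    have hp : p = 0 := (mul_eq_zero.mp h0).resolve_right (nonZeroDivisors.ne_zero q.2)
    simp [hp]
  · right; left
    have := congrArg (algebraMap GaussianInt K) h1
    simp only [map_pow] at this
    rw [div_pow, this, div_self (pow_ne_zero 2 hq)]
  · right; right
    have := congrArg (algebraMap GaussianInt K) h2
    simp only [map_pow, map_neg] at this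
    rw [div_pow, this, neg_div, div_self (pow_ne_zero 2 hq)]

lemma one_add_algebraMap_i_ne_zero : 1 + algebraMap GaussianInt K i ≠ 0 := by
  have := (map_ne_zero_iff _ (IsFractionRing.injective GaussianInt K)).mpr
    prime_one_add_i.ne_zero
  simpa using this

theorem sq_ne_i (z : K) : z ^ 2 ≠ algebraMap _ K i := by
  intro h
  obtain ⟨v, rfl⟩ := exists_algebraMap_eq_of_sq_eq h
  rw [← map_pow] at h
  obtain ⟨a, b⟩ := v
  have h1 := congrArg Zsqrtd.im (IsFractionRing.injective GaussianInt K h)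
  simp [i, pow_two] at h1
  lia

theorem sq_ne_neg_i (z : K) : z ^ 2 ≠ -algebraMap _ K i := by
  intro h
  have hI := algebraMap_i_sq (K := K)
  refine sq_ne_i (algebraMap _ K i * z) ?_
  linear_combination z ^ 2 * hI - h

theorem sq_ne_neg_two (z : K) : z ^ 2 ≠ -2 := by
  intro h
  have hI := algebraMap_i_sq (K := K)
  have h0 := one_add_algebraMap_i_ne_zero (K := K)
  refine sq_ne_i (z / (1 + algebraMap _ K i)) ?_
  rw [div_pow, div_eq_iff (pow_ne_zero 2 h0)]
  linear_combination h - (algebraMap _ K i + 2) * hI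

theorem sq_ne_two (z : K) : z ^ 2 ≠ 2 := by
  intro h
  have hI := algebraMap_i_sq (K := K)
  refine sq_ne_neg_two (algebraMap _ K i * z) ?_
  linear_combination z ^ 2 * hI - h

/-- The affine points of `y² = 2t(1 + t²)` over `ℚ(i)`: the substitution `u = it` leads to
`y² = u³ - u`. -/
theorem eq_zero_or_sq_eq_of_sq_eq_two_mul_one_add_sq {t y : K} (h : y ^ 2 = 2 * t * (1 + t ^ 2)) :
    t = 0 ∨ t ^ 2 = 1 ∨ t ^ 2 = -1 := by
  have hI := algebraMap_i_sq (K := K)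
  have h0 := one_add_algebraMap_i_ne_zero (K := K)
  set j := algebraMap GaussianInt K i
  have key : (j * t) * ((j * t) ^ 2 - 1) =
      algebraMap GaussianInt K 1 * (y / (1 + j)) ^ 2 := by
    rw [map_one, one_mul, div_pow, h, eq_div_iff (pow_ne_zero 2 h0)]
    linear_combination (j ^ 3 * t ^ 3 - j * t + 2 * t ^ 3 * (j ^ 2 - 1) - 2 * t) * hI
  rcases eq_zero_or_sq_eq_of_mul_sq_eq isUnit_one key with h1 | h1 | h1
  · left
    linear_combination -j * h1 + t * hI
  · right; right
    linear_combination -h1 + t ^ 2 * hI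
  · right; left
    linear_combination -h1 + t ^ 2 * hI

/-- The affine points of `y² = 2t(1 - t²)` over `ℚ(i)`; up to squares, `-2` is the unit `i`, which
is not a square. -/
theorem eq_zero_or_sq_eq_of_sq_eq_two_mul_one_sub_sq {t y : K} (h : y ^ 2 = 2 * t * (1 - t ^ 2)) :
    t = 0 ∨ t ^ 2 = 1 := by
  have hI := algebraMap_i_sq (K := K)
  have h0 := one_add_algebraMap_i_ne_zero (K := K)
  set j := algebraMap GaussianInt K i with hj
  have key : t * (t ^ 2 - 1) = algebraMap _ K (-i) * (y / (1 + j)) ^ 2 := by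
    rw [map_neg, div_pow, h, ← mul_div_assoc, eq_div_iff (pow_ne_zero 2 h0)]
    linear_combination t * (t ^ 2 - 1) * hI
  rcases eq_zero_or_sq_eq_of_mul_sq_eq isUnit_i.neg key with h1 | h1 | h1
  · exact Or.inl h1
  · exact Or.inr h1
  · exfalso
    have ht : (t - j) * (t + j) = 0 := by linear_combination h1 - hI
    have h4 : (y / 2) ^ 2 = t := by
      have h2 : (2 : K) ≠ 0 := by
        have := (map_ne_zero_iff _ (IsFractionRing.injective GaussianInt K)).mpr
          (two_ne_zero (α := GaussianInt))
        rwa [map_ofNat] at this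
      rw [div_pow, div_eq_iff (pow_ne_zero 2 h2)]
      linear_combination h - 2 * t * h1
    rcases mul_eq_zero.mp ht with h5 | h5
    · exact sq_ne_i (y / 2) (by rw [h4]; linear_combination h5)
    · exact sq_ne_neg_i (y / 2) (by rw [h4]; linear_combination h5)

end FractionField

end GaussianInt

/-! ### `ℚ(i)` as the fraction field of `ℤ[i]` -/

lemma GaussianField.exists_eq_add_mul (x : GaussianField) :
    ∃ a b : ℚ, x = (a : GaussianField) + b * IntermediateField.AdjoinSimple.gen ℚ Complex.I := by
  obtain ⟨x, hx⟩ := x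
  suffices h : ∃ a b : ℚ, x = (a : ℂ) + b * Complex.I by
    obtain ⟨a, b, h⟩ := h
    refine ⟨a, b, Subtype.ext ?_⟩
    simp [h]
  induction hx using IntermediateField.adjoin_induction with
  | mem x hx =>
    obtain rfl := hx
    exact ⟨0, 1, by simp⟩
  | algebraMap x => exact ⟨x, 0, by simp⟩
  | add x y _ _ hx hy =>
    obtain ⟨a, b, rfl⟩ := hx
    obtain ⟨c, d, rfl⟩ := hy
    exact ⟨a + c, b + d, by push_cast; ring⟩
  | inv x _ hx =>
    obtain ⟨a, b, rfl⟩ := hx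
    refine ⟨a / (a ^ 2 + b ^ 2), -b / (a ^ 2 + b ^ 2), ?_⟩
    apply Complex.ext <;> simp [Complex.normSq, pow_two] <;> norm_cast <;> ring
  | mul x y _ _ hx hy =>
    obtain ⟨a, b, rfl⟩ := hx
    obtain ⟨c, d, rfl⟩ := hy
    exact ⟨a * c - b * d, a * d + b * c, by
      push_cast; linear_combination (b * d : ℂ) * Complex.I_sq⟩

lemma GaussianField.gen_mul_gen :
    IntermediateField.AdjoinSimple.gen ℚ Complex.I * IntermediateField.AdjoinSimple.gen ℚ Complex.I
      = ((-1 : ℤ) : GaussianField) := by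
  apply Subtype.ext
  simp

/-- The embedding of `ℤ[i]` into `ℚ(i)`. -/
noncomputable instance GaussianField.algebraGaussianInt : Algebra GaussianInt GaussianField :=
  (Zsqrtd.lift ⟨IntermediateField.AdjoinSimple.gen ℚ Complex.I,
    GaussianField.gen_mul_gen⟩).toAlgebra

lemma GaussianField.algebraMap_mk (a b : ℤ) :
    algebraMap GaussianInt GaussianField ⟨a, b⟩ =
      a + b * IntermediateField.AdjoinSimple.gen ℚ Complex.I := by
  rfl

instance GaussianField.faithfulSMul : FaithfulSMul GaussianInt GaussianField := by
  rw [faithfulSMul_iff_algebraMap_injective]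
  intro x y h
  apply GaussianInt.toComplex_injective
  obtain ⟨a, b⟩ := x
  obtain ⟨c, d⟩ := y
  rw [algebraMap_mk, algebraMap_mk] at h
  have h1 := congrArg (Subtype.val : GaussianField → ℂ) h
  simpa [GaussianInt.toComplex_def'] using h1

instance GaussianField.isFractionRing : IsFractionRing GaussianInt GaussianField := by
  refine IsFractionRing.of_field _ _ fun z => ?_
  obtain ⟨a, b, rfl⟩ := exists_eq_add_mul z
  refine ⟨⟨a.num * b.den, b.num * a.den⟩, ⟨a.den * b.den, 0⟩, ?_⟩
  rw [algebraMap_mk, algebraMap_mk]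
  have ha : (a.den : GaussianField) ≠ 0 := by exact_mod_cast a.den_ne_zero
  have hb : (b.den : GaussianField) ≠ 0 := by exact_mod_cast b.den_ne_zero
  rw [Rat.cast_def a, Rat.cast_def b]
  push_cast
  field_simp
  ring

/-! ### The quartic over a quadratic extension of `ℚ(i)` -/

namespace FermatQuartic

section Coefficients

variable {K : Type*} [Field K] [CharZero K] [Algebra GaussianInt K] [IsFractionRing GaussianInt K]

/-- Let `t² + βt + γ` be irreducible over `ℚ(i)`.  The hypotheses `h1`, `h2` say that it divides
`2t(1 + t²) - (ρ + σt)²`, and `h3`, `h4` that it divides `2t(1 - t²) - (ρ' + σ't)²`.  The third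
roots `β + σ²/2` and `β - σ'²/2` of these cubics are abscissas of rational points on the two
elliptic curves, which leaves finitely many cases. -/
theorem coefficients_of_dvd_of_dvd {β γ ρ σ ρ' σ' : K} (hirr : ∀ k : K, k ^ 2 + β * k + γ ≠ 0)
    (h1 : ρ ^ 2 - σ ^ 2 * γ = 2 * β * γ) (h2 : 2 * ρ * σ - σ ^ 2 * β = 2 * (1 + β ^ 2 - γ))
    (h3 : ρ' ^ 2 - σ' ^ 2 * γ = -2 * β * γ)
    (h4 : 2 * ρ' * σ' - σ' ^ 2 * β = 2 * (1 - β ^ 2 + γ)) :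
    ((2 * β) ^ 2 = 1 ∧ 2 * γ = 1) ∨ (β ^ 2 = 1 ∧ γ = 2) := by
  have hI := GaussianInt.algebraMap_i_sq (K := K)
  obtain ⟨r, hr⟩ : ∃ r, r = β + σ ^ 2 / 2 := ⟨_, rfl⟩
  obtain ⟨r', hr'⟩ : ∃ r', r' = β - σ' ^ 2 / 2 := ⟨_, rfl⟩
  have hσ : σ ^ 2 = 2 * (r - β) := by rw [hr]; ring
  have hσ' : σ' ^ 2 = 2 * (β - r') := by rw [hr']; ring
  have hA : (ρ + σ * r) ^ 2 = 2 * r * (1 + r ^ 2) := by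
    linear_combination h1 + r * h2 + (γ + β * r + r ^ 2) * hσ
  have hB : (ρ' + σ' * r') ^ 2 = 2 * r' * (1 - r' ^ 2) := by
    linear_combination h3 + r' * h4 + (γ + β * r' + r' ^ 2) * hσ'
  -- The values of the quadratic at `r` and `r'`, from the derivatives of the two cubics.
  have hF : r ^ 2 + β * r + γ = 1 + 3 * r ^ 2 - σ * (ρ + σ * r) := by
    linear_combination h2 / 2 + (r + β / 2) * hσ
  have hF' : r' ^ 2 + β * r' + γ = -1 + 3 * r' ^ 2 + σ' * (ρ' + σ' * r') := by
    linear_combination -h4 / 2 - (r' + β / 2) * hσ'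
  -- All the affine points of the second curve have ordinate `0`.
  have hγ : γ = 2 * r' ^ 2 - 1 - β * r' := by
    have h0 : ρ' + σ' * r' = 0 := by
      rw [← pow_eq_zero_iff two_ne_zero, hB]
      rcases GaussianInt.eq_zero_or_sq_eq_of_sq_eq_two_mul_one_sub_sq hB with h | h <;> rw [h] <;>
        ring
    rw [h0] at hF'
    linear_combination hF'
  have hroot : r' = 0 ∨ r' ^ 2 = 1 :=
    GaussianInt.eq_zero_or_sq_eq_of_sq_eq_two_mul_one_sub_sq hB
  rcases GaussianInt.eq_zero_or_sq_eq_of_sq_eq_two_mul_one_add_sq hA with h | h | h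
  · have hγ1 : γ = 1 := by
      have h0 : ρ = 0 := by
        rw [h] at hA
        simpa using hA
      rw [h, h0] at hF
      linear_combination hF
    exfalso
    rcases hroot with h' | h'
    · rw [h', hγ1] at hγ
      exact two_ne_zero (α := K) (by linear_combination hγ)
    · have hβ : β = 0 := by linear_combination -r' * hγ1 + r' * hγ + (2 * r' - β) * h'
      refine hirr (algebraMap _ K GaussianInt.i) ?_
      rw [hβ, hγ1, hI]
      ring
  · -- After multiplication by `r = ±1`, the cases `r = 1` and `r = -1` agree.
    obtain ⟨τ, hτ⟩ : ∃ τ, τ = σ * (ρ + σ * r) / 2 := ⟨_, rfl⟩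
    have hτ2 : τ ^ 2 = 2 - 2 * (β * r) := by
      rw [hτ]
      linear_combination σ ^ 2 / 4 * hA + (r + r ^ 3) / 2 * hσ + (r ^ 2 - β * r + 2) * h
    have hγ2 : γ = 3 - 2 * τ - β * r := by
      linear_combination hF + 2 * hτ + 2 * h
    have hβ : β = β * r * r := by linear_combination -β * h
    generalize β * r = b at *
    rcases hroot with h' | h'
    · exfalso
      refine GaussianInt.sq_ne_neg_two (τ - 2) ?_
      rw [h'] at hγ
      linear_combination hτ2 - 2 * hγ2 + 2 * hγ
    · have hrr : (r' - r) * (r' + r) = 0 := by linear_combination h' - h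
      rcases mul_eq_zero.mp hrr with h'' | h''
      · obtain rfl : r' = r := by linear_combination h''
        left
        have hτ1 : τ = 1 := by
          linear_combination (hγ2 - hγ - 2 * h + r' * hβ + b * h) / 2
        rw [hτ1] at hτ2 hγ2
        have hb : b = 1 / 2 := by linear_combination hτ2 / 2
        rw [hb] at hγ2 hβ
        constructor
        · rw [hβ]
          linear_combination h
        · linear_combination 2 * hγ2
      · obtain rfl : r' = -r := by linear_combination h''
        have hb : b = 1 - τ := by
          linear_combination (hγ2 - hγ - 2 * h - r * hβ - b * h) / 2
        have h0 : τ * (τ - 2) = 0 := by linear_combination hτ2 - 2 * hb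
        rcases mul_eq_zero.mp h0 with h3 | h3
        · right
          rw [h3] at hb hγ2
          rw [hb] at hγ2 hβ
          constructor
          · rw [hβ]
            linear_combination h
          · linear_combination hγ2
        · exfalso
          obtain rfl : τ = 2 := by linear_combination h3
          refine hirr 0 ?_
          linear_combination hγ2 - hb
  · exfalso
    have h0 : ρ + σ * r = 0 := by
      rw [← pow_eq_zero_iff two_ne_zero, hA, h]
      ring
    have hγ2 : γ = -1 - β * r := by
      rw [h0] at hF
      linear_combination hF + 2 * h
    rcases hroot with h' | h'
    · have hβ : β = 0 := by
        rw [h'] at hγ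
        linear_combination -r * (hγ2 - hγ) + β * h
      refine hirr 1 ?_
      rw [hγ2, hβ]
      ring
    · have h1r : 1 - r * r' ≠ 0 := by
        intro h3
        have : (2 : K) = 0 := by
          linear_combination (1 + r * r') * h3 + r ^ 2 * h' + h
        exact two_ne_zero this
      have hβ : β = r' + r := by
        apply mul_left_cancel₀ h1r
        linear_combination -r' * (hγ2 - hγ) + (2 * r' - β + r) * h' + r' * h
      rcases sq_eq_one_iff.mp h' with rfl | rfl
      · refine GaussianInt.sq_ne_neg_two σ ?_
        rw [hσ, hβ]
        ring
      · refine GaussianInt.sq_ne_two σ ?_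
        rw [hσ, hβ]
        ring

end Coefficients

section Quadratic

variable {K L : Type*} [Field K] [Field L] [Algebra K L]

lemma eq_zero_of_add_mul_eq_zero {t : L} (ht : t ∉ (algebraMap K L).range) {ρ σ : K}
    (h : algebraMap K L ρ + algebraMap K L σ * t = 0) : ρ = 0 ∧ σ = 0 := by
  have hσ : σ = 0 := by
    by_contra hσ
    have hσ' : algebraMap K L σ ≠ 0 := by simpa using hσ
    refine ht ⟨-ρ / σ, ?_⟩
    rw [map_div₀, map_neg, div_eq_iff hσ']
    linear_combination -h
  refine ⟨?_, hσ⟩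
  simpa [hσ] using h

lemma exists_eq_add_mul_of_finrank_eq_two (hL : Module.finrank K L = 2) {t : L}
    (ht : t ∉ (algebraMap K L).range) (w : L) :
    ∃ ρ σ : K, w = algebraMap K L ρ + algebraMap K L σ * t := by
  have : FiniteDimensional K L := FiniteDimensional.of_finrank_pos (by omega)
  let f : K × K →ₗ[K] L :=
    (Algebra.linearMap K L).coprod ((LinearMap.mulRight K t).comp (Algebra.linearMap K L))
  have hf : Function.Injective f := by
    rw [injective_iff_map_eq_zero]
    rintro ⟨ρ, σ⟩ h
    exact Prod.ext_iff.mpr (eq_zero_of_add_mul_eq_zero ht (by simpa [f] using h))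
  have hs : Function.Surjective f :=
    (LinearMap.injective_iff_surjective_of_finrank_eq_finrank (by simp [hL])).mp hf
  obtain ⟨⟨ρ, σ⟩, h⟩ := hs w
  exact ⟨ρ, σ, by simpa [f] using h.symm⟩

/-- If the squares of two elements of a quadratic extension lie in the base field, then so does one
of the elements or their product. -/
lemma mem_range_or_mul_mem_range [CharZero K] (hL : Module.finrank K L = 2) {z w : L}
    (hz : z ^ 2 ∈ (algebraMap K L).range) (hw : w ^ 2 ∈ (algebraMap K L).range) :
    z ∈ (algebraMap K L).range ∨ w ∈ (algebraMap K L).range ∨ z * w ∈ (algebraMap K L).range := by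
  by_cases h : z ∈ (algebraMap K L).range
  · exact Or.inl h
  right
  obtain ⟨a, ha⟩ := hz
  obtain ⟨b, hb⟩ := hw
  obtain ⟨ρ, σ, rfl⟩ := exists_eq_add_mul_of_finrank_eq_two hL h w
  have h1 : algebraMap K L (ρ ^ 2 + σ ^ 2 * a - b) + algebraMap K L (2 * (ρ * σ)) * z = 0 := by
    simp only [map_add, map_sub, map_mul, map_pow, map_ofNat]
    linear_combination algebraMap K L σ ^ 2 * ha - hb
  have h2 := (eq_zero_of_add_mul_eq_zero h h1).2
  rcases mul_eq_zero.mp ((mul_eq_zero.mp h2).resolve_left two_ne_zero) with h3 | h3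
  · right
    refine ⟨σ * a, ?_⟩
    rw [h3, map_mul, ha, map_zero]
    ring
  · left
    exact ⟨ρ, by simp [h3]⟩

variable [CharZero K] [Algebra GaussianInt K] [IsFractionRing GaussianInt K]

/-- If `t ∉ K` is the abscissa of `L`-points of both elliptic curves, its minimal polynomial is
`T² ± T/2 + 1/2` or `T² ± T + 2`; the conclusion states this after completing the square. -/
theorem sq_eq_neg_seven_of_notMem_range (hL : Module.finrank K L = 2) {t y w : L}
    (ht : t ∉ (algebraMap K L).range) (hy : y ^ 2 = 2 * t * (1 + t ^ 2))
    (hw : w ^ 2 = 2 * t * (1 - t ^ 2)) :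
    ∃ e : L, e ^ 2 = 1 ∧ ((4 * t + e) ^ 2 = -7 ∨ (2 * t + e) ^ 2 = -7) := by
  obtain ⟨γ₀, β₀, h0⟩ := exists_eq_add_mul_of_finrank_eq_two hL ht (t ^ 2)
  obtain ⟨γ, rfl⟩ : ∃ γ, γ₀ = -γ := ⟨-γ₀, by simp⟩
  obtain ⟨β, rfl⟩ : ∃ β, β₀ = -β := ⟨-β₀, by simp⟩
  obtain ⟨ρ, σ, rfl⟩ := exists_eq_add_mul_of_finrank_eq_two hL ht y
  obtain ⟨ρ', σ', rfl⟩ := exists_eq_add_mul_of_finrank_eq_two hL ht w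
  rw [map_neg, map_neg] at h0
  set f := algebraMap K L
  have hirr : ∀ k : K, k ^ 2 + β * k + γ ≠ 0 := by
    intro k hk
    have hk' := congrArg f hk
    simp only [map_add, map_mul, map_pow, map_zero] at hk'
    have h1 : (t - f k) * (t + f k + f β) = 0 := by
      linear_combination h0 - hk'
    rcases mul_eq_zero.mp h1 with h2 | h2
    · exact ht ⟨k, by linear_combination -h2⟩
    · exact ht ⟨-k - β, by rw [map_sub, map_neg]; linear_combination -h2⟩
  have e1 := eq_zero_of_add_mul_eq_zero ht (ρ := ρ ^ 2 - σ ^ 2 * γ - 2 * β * γ)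
    (σ := 2 * ρ * σ - σ ^ 2 * β - 2 * (1 + β ^ 2 - γ)) (by
      simp only [map_add, map_sub, map_mul, map_pow, map_ofNat, map_one]
      linear_combination hy + (2 * (t - f β) - f σ ^ 2) * h0)
  have e2 := eq_zero_of_add_mul_eq_zero ht (ρ := ρ' ^ 2 - σ' ^ 2 * γ - -2 * β * γ)
    (σ := 2 * ρ' * σ' - σ' ^ 2 * β - 2 * (1 - β ^ 2 + γ)) (by
      simp only [map_add, map_sub, map_mul, map_pow, map_ofNat, map_one, map_neg]
      linear_combination hw + (-2 * (t - f β) - f σ' ^ 2) * h0)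
  rcases coefficients_of_dvd_of_dvd hirr (sub_eq_zero.mp e1.1) (sub_eq_zero.mp e1.2)
    (sub_eq_zero.mp e2.1) (sub_eq_zero.mp e2.2) with ⟨h1, h2⟩ | ⟨h1, h2⟩
  · have h1' := congrArg f h1
    have h2' := congrArg f h2
    simp only [map_mul, map_pow, map_ofNat, map_one] at h1' h2'
    refine ⟨2 * f β, h1', Or.inl ?_⟩
    linear_combination 16 * h0 + h1' - 8 * h2'
  · have h1' := congrArg f h1
    have h2' := congrArg f h2
    simp only [map_pow, map_ofNat, map_one] at h1' h2'
    refine ⟨f β, h1', Or.inr ?_⟩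
    linear_combination 4 * h0 + h1' - 4 * h2'

/-- The points of the quartic with `y` and `x²` in `K` are trivial: `t = (1 - x²) / y²` is then the
abscissa of a point of `Y² = 2t(1 + t²)` with `Y = y(1 + t²)`. -/
lemma mul_eq_zero_of_mem_range {x y : L} (hxy : x ^ 4 + y ^ 4 = 1)
    (hx : x ^ 2 ∈ (algebraMap K L).range) (hy : y ∈ (algebraMap K L).range) : x * y = 0 := by
  obtain ⟨a, ha⟩ := hx
  obtain ⟨b, rfl⟩ := hy
  by_cases hb : b = 0
  · simp [hb]
  have hab : a ^ 2 + b ^ 4 = 1 := by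
    apply (algebraMap K L).injective
    simp only [map_add, map_pow, map_one, ha]
    linear_combination hxy
  obtain ⟨t, ht⟩ : ∃ t, t = (1 - a) / b ^ 2 := ⟨_, rfl⟩
  have htb : t * b ^ 2 = 1 - a := by rw [ht]; field_simp
  have hb2 := pow_ne_zero 2 hb
  have h1 : b ^ 2 * (1 + t ^ 2) = 2 * t := by
    apply mul_left_cancel₀ hb2
    linear_combination (t * b ^ 2 - 1 - a) * htb + hab
  have h2 : (b * (1 + t ^ 2)) ^ 2 = 2 * t * (1 + t ^ 2) := by
    linear_combination (1 + t ^ 2) * h1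
  have ha0 : a = 0 := by
    rcases GaussianInt.eq_zero_or_sq_eq_of_sq_eq_two_mul_one_add_sq h2 with h | h | h
    · exfalso
      rw [h] at h1
      exact hb2 (by linear_combination h1)
    · rw [h] at h1
      linear_combination htb - t * h1 / 2 - h
    · exfalso
      have : t = 0 := by linear_combination -h1 / 2 + b ^ 2 / 2 * h
      rw [this] at h
      simp at h
  rw [ha0, map_zero, eq_comm, pow_eq_zero_iff two_ne_zero] at ha
  rw [ha, zero_mul]

/-- A nontrivial point of the quartic is given by `x² = (1 - t²) / (1 + t²)`, `y² = 2t / (1 + t²)`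
with `t ∉ K`: for `t ∈ K` one of `x`, `y`, `x y` lies in `K`, and each case leads to a rational
point of one of the elliptic curves. -/
theorem exists_parameter_of_mul_ne_zero (hL : Module.finrank K L = 2) {x y : L}
    (hxy : x ^ 4 + y ^ 4 = 1) (h0 : x * y ≠ 0) :
    ∃ t e : L, t ∉ (algebraMap K L).range ∧ 1 + t ^ 2 ≠ 0 ∧ x ^ 2 * (1 + t ^ 2) = 1 - t ^ 2 ∧
      y ^ 2 * (1 + t ^ 2) = 2 * t ∧ e ^ 2 = 1 ∧ ((4 * t + e) ^ 2 = -7 ∨ (2 * t + e) ^ 2 = -7) := by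
  have hchar : CharZero L := charZero_of_injective_algebraMap (algebraMap K L).injective
  have hx := left_ne_zero_of_mul h0
  have hy := right_ne_zero_of_mul h0
  have hy2 := pow_ne_zero 2 hy
  obtain ⟨t, ht⟩ : ∃ t, t = (1 - x ^ 2) / y ^ 2 := ⟨_, rfl⟩
  have hty : t * y ^ 2 = 1 - x ^ 2 := by rw [ht]; field_simp
  have h1 : y ^ 2 * (1 + t ^ 2) = 2 * t := by
    apply mul_left_cancel₀ hy2
    linear_combination (t * y ^ 2 - 1 - x ^ 2) * hty + hxy
  have h2 : x ^ 2 * (1 + t ^ 2) = 1 - t ^ 2 := by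
    linear_combination (1 + t ^ 2) * hty - t * h1
  have h3 : 1 + t ^ 2 ≠ 0 := by
    intro h
    rw [h, mul_zero] at h1 h2
    exact two_ne_zero (α := L) (by linear_combination h - h2)
  have h4 : t ≠ 0 := by
    rintro rfl
    exact hy2 (by linear_combination h1)
  have hW : (x * y * (1 + t ^ 2)) ^ 2 = 2 * t * (1 - t ^ 2) := by
    linear_combination y ^ 2 * (1 + t ^ 2) * h2 + (1 - t ^ 2) * h1
  have ht' : t ∉ (algebraMap K L).range := by
    rintro htK
    have hx2 : x ^ 2 ∈ (algebraMap K L).fieldRange := by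
      have htK' : t ∈ (algebraMap K L).fieldRange := htK
      rw [show x ^ 2 = (1 - t ^ 2) / (1 + t ^ 2) by rw [← h2]; field_simp]
      exact div_mem (sub_mem (one_mem _) (pow_mem htK' 2)) (add_mem (one_mem _) (pow_mem htK' 2))
    have hy2 : y ^ 2 ∈ (algebraMap K L).fieldRange := by
      have htK' : t ∈ (algebraMap K L).fieldRange := htK
      rw [show y ^ 2 = (t + t) / (1 + t ^ 2) by rw [← two_mul, ← h1]; field_simp]
      exact div_mem (add_mem htK' htK') (add_mem (one_mem _) (pow_mem htK' 2))
    rcases mem_range_or_mul_mem_range hL hx2 hy2 with h | h | h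
    · exact h0 (by rw [mul_comm]; exact mul_eq_zero_of_mem_range (by rw [← hxy]; ring) hy2 h)
    · exact h0 (mul_eq_zero_of_mem_range hxy hx2 h)
    · obtain ⟨s, rfl⟩ := htK
      obtain ⟨c, hc⟩ := h
      rw [← hc] at hW
      have hW' : (c * (1 + s ^ 2)) ^ 2 = 2 * s * (1 - s ^ 2) := by
        apply (algebraMap K L).injective
        simp only [map_mul, map_add, map_sub, map_pow, map_one, map_ofNat]
        exact hW
      rcases GaussianInt.eq_zero_or_sq_eq_of_sq_eq_two_mul_one_sub_sq hW' with h5 | h5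
      · exact h4 (by rw [h5, map_zero])
      · have h6 := congrArg (algebraMap K L) h5
        rw [map_pow, map_one] at h6
        exact mul_ne_zero (pow_ne_zero 2 hx) h3 (by linear_combination h2 - h6)
  have hY : (y * (1 + t ^ 2)) ^ 2 = 2 * t * (1 + t ^ 2) := by
    linear_combination (1 + t ^ 2) * h1
  obtain ⟨e, he, h⟩ := sq_eq_neg_seven_of_notMem_range hL ht' hY hW
  exact ⟨t, e, ht', h3, h2, h1, he, h⟩

end Quadratic

end FermatQuartic

/-! ### The points of the quartic -/

lemma exists_sign_of_sq_eq {L : Type*} [Field L] {s u e : L} (hs : s ^ 2 = -7)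
    (hu : u ^ 2 = -7) (he : e ^ 2 = 1) :
    ∃ d : L, (d = 1 ∨ d = -1) ∧ e * u = d * s ∧ (d * s) ^ 2 = -7 := by
  have h2 : (e * u) ^ 2 = s ^ 2 := by rw [mul_pow, he, hu, hs, one_mul]
  rcases sq_eq_sq_iff_eq_or_eq_neg.mp h2 with h3 | h3
  · exact ⟨1, by simp, by rw [h3]; ring, by rw [one_mul, hs]⟩
  · exact ⟨-1, by simp, by rw [h3]; ring, by rw [← hs]; ring⟩

section Points

variable {L : Type*} [Field L] [Algebra GaussianField L]

lemma imagUnit_sq : imagUnit L ^ 2 = -1 := by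
  have h := congrArg (algebraMap GaussianField L) GaussianField.gen_mul_gen
  rw [map_mul, map_intCast] at h
  rw [pow_two, imagUnit, h]
  simp

lemma exists_mem_units_of_sq_eq {x A : L} (h : x ^ 2 = A ^ 2 ∨ x ^ 2 = -A ^ 2) :
    ∃ e ∈ ({1, -1, imagUnit L, -imagUnit L} : Set L), x = e * A := by
  have hI := imagUnit_sq (L := L)
  rcases h with h | h
  · rcases sq_eq_sq_iff_eq_or_eq_neg.mp h with h | h
    · exact ⟨1, by simp, by rw [h]; ring⟩
    · exact ⟨-1, by simp, by rw [h]; ring⟩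
  · have h' : x ^ 2 = (imagUnit L * A) ^ 2 := by linear_combination h - A ^ 2 * hI
    rcases sq_eq_sq_iff_eq_or_eq_neg.mp h' with h | h
    · exact ⟨imagUnit L, by simp, h⟩
    · exact ⟨-imagUnit L, by simp, by rw [h]; ring⟩

lemma pow_four_eq_one_of_mem_units {e : L}
    (h : e ∈ ({1, -1, imagUnit L, -imagUnit L} : Set L)) : e ^ 4 = 1 := by
  have hI := imagUnit_sq (L := L)
  rcases h with rfl | rfl | rfl | rfl
  · ring
  · ring
  · linear_combination (imagUnit L ^ 2 - 1) * hI
  · linear_combination (imagUnit L ^ 2 - 1) * hI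

lemma mem_units_of_pow_four_eq_one {x : L} (h : x ^ 4 = 1) :
    x = 1 ∨ x = -1 ∨ x = imagUnit L ∨ x = -imagUnit L := by
  have h1 : (x ^ 2) ^ 2 = 1 ^ 2 := by linear_combination h
  obtain ⟨e, he, rfl⟩ := exists_mem_units_of_sq_eq (x := x) (A := 1)
    (by simpa using sq_eq_sq_iff_eq_or_eq_neg.mp h1)
  simpa using he

lemma axisPoints_subset : axisPoints L ⊆ quarticSolutions L := by
  have hI : imagUnit L ^ 4 = 1 := pow_four_eq_one_of_mem_units (by simp)
  rintro p (rfl | rfl | rfl | rfl | rfl | rfl | rfl | rfl) <;>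
    simp [quarticSolutions, hI, Even.neg_pow (by decide : Even 4)]

lemma mem_axisPoints_of_mul_eq_zero {x y : L} (h : x ^ 4 + y ^ 4 = 1) (h0 : x * y = 0) :
    (x, y) ∈ axisPoints L := by
  rcases mul_eq_zero.mp h0 with rfl | rfl
  · rcases mem_units_of_pow_four_eq_one (x := y) (by simpa using h) with rfl | rfl | rfl | rfl <;>
      simp [axisPoints]
  · rcases mem_units_of_pow_four_eq_one (x := x) (by simpa using h) with rfl | rfl | rfl | rfl <;>
      simp [axisPoints]

lemma sqrtPoints_subset {s : L} (hs : s ^ 2 = -7) : sqrtPoints L s ⊆ quarticSolutions L := by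
  have : CharZero L := charZero_of_injective_algebraMap (algebraMap GaussianField L).injective
  rintro p ⟨e₁, h₁, e₂, h₂, e₃, h₃, rfl⟩
  have h1 := pow_four_eq_one_of_mem_units h₁
  have h2 := pow_four_eq_one_of_mem_units h₂
  have h3 : e₃ ^ 2 = 1 := by rcases h₃ with rfl | rfl <;> ring
  change (e₁ * ((1 + e₃ * s) / 2)) ^ 4 + (e₂ * ((1 - e₃ * s) / 2)) ^ 4 = 1
  rw [mul_pow, mul_pow, h1, h2]
  have h4 : (e₃ * s) ^ 2 = -7 := by rw [mul_pow, h3, hs, one_mul]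
  linear_combination ((e₃ * s) ^ 2 - 1) / 8 * h4

lemma mem_sqrtPoints_of_sq_eq {s x y e : L} (he : e = 1 ∨ e = -1)
    (hx : x ^ 2 = ((1 + e * s) / 2) ^ 2 ∨ x ^ 2 = -((1 + e * s) / 2) ^ 2)
    (hy : y ^ 2 = ((1 - e * s) / 2) ^ 2 ∨ y ^ 2 = -((1 - e * s) / 2) ^ 2) :
    (x, y) ∈ sqrtPoints L s := by
  obtain ⟨e₁, h₁, rfl⟩ := exists_mem_units_of_sq_eq hx
  obtain ⟨e₂, h₂, rfl⟩ := exists_mem_units_of_sq_eq hy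
  exact ⟨e₁, h₁, e₂, h₂, e, he, rfl⟩

/-- The points with parameter `t = ±(±s - 1) / 4`. -/
lemma mem_sqrtPoints_of_four_mul {s t e x y : L} (hs : s ^ 2 = -7) (ht : 1 + t ^ 2 ≠ 0)
    (hx : x ^ 2 * (1 + t ^ 2) = 1 - t ^ 2) (hy : y ^ 2 * (1 + t ^ 2) = 2 * t) (he : e ^ 2 = 1)
    (h : (4 * t + e) ^ 2 = -7) : (x, y) ∈ sqrtPoints L s := by
  have : CharZero L := charZero_of_injective_algebraMap (algebraMap GaussianField L).injective
  obtain ⟨d, hd, h1, hd2⟩ := exists_sign_of_sq_eq hs h he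
  have htd : t = e * (d * s - 1) / 4 := by linear_combination e * h1 / 4 - (4 * t + e) / 4 * he
  generalize hr : d * s = r at *
  refine mem_sqrtPoints_of_sq_eq (e := -d) (by rcases hd with rfl | rfl <;> simp) ?_ ?_
  · right
    rw [neg_mul, hr]
    apply mul_right_cancel₀ ht
    rw [hx, htd]
    rcases sq_eq_one_iff.mp he with rfl | rfl <;>
      linear_combination (-(3 + r) / 32 + (1 + (r - 1) ^ 2 / 16) / 4) * hd2
  · rw [neg_mul, hr]
    rcases sq_eq_one_iff.mp he with rfl | rfl
    · left
      apply mul_right_cancel₀ ht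
      rw [hy, htd]
      linear_combination ((3 - r) / 32 + 1 / 16 - (1 + (r - 1) ^ 2 / 16) / 4) * hd2
    · right
      apply mul_right_cancel₀ ht
      rw [hy, htd]
      linear_combination (-(3 - r) / 32 - 1 / 16 + (1 + (r - 1) ^ 2 / 16) / 4) * hd2

/-- The points with parameter `t = ±(±s - 1) / 2`. -/
lemma mem_sqrtPoints_of_two_mul {s t e x y : L} (hs : s ^ 2 = -7) (ht : 1 + t ^ 2 ≠ 0)
    (hx : x ^ 2 * (1 + t ^ 2) = 1 - t ^ 2) (hy : y ^ 2 * (1 + t ^ 2) = 2 * t) (he : e ^ 2 = 1)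
    (h : (2 * t + e) ^ 2 = -7) : (x, y) ∈ sqrtPoints L s := by
  have : CharZero L := charZero_of_injective_algebraMap (algebraMap GaussianField L).injective
  obtain ⟨d, hd, h1, hd2⟩ := exists_sign_of_sq_eq hs h he
  have htd : t = e * (d * s - 1) / 2 := by linear_combination e * h1 / 2 - (2 * t + e) / 2 * he
  generalize hr : d * s = r at *
  refine mem_sqrtPoints_of_sq_eq (e := d) hd ?_ ?_
  · left
    rw [hr]
    apply mul_right_cancel₀ ht
    rw [hx, htd]
    rcases sq_eq_one_iff.mp he with rfl | rfl <;>
      linear_combination ((3 - r) / 8 - (1 + (r - 1) ^ 2 / 4) / 4) * hd2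
  · rw [hr]
    rcases sq_eq_one_iff.mp he with rfl | rfl
    · left
      apply mul_right_cancel₀ ht
      rw [hy, htd]
      linear_combination ((3 + r) / 8 - 1 / 4 - (1 + (r - 1) ^ 2 / 4) / 4) * hd2
    · right
      apply mul_right_cancel₀ ht
      rw [hy, htd]
      linear_combination (-(3 + r) / 8 + 1 / 4 + (1 + (r - 1) ^ 2 / 4) / 4) * hd2

end Points

lemma adjoin_eq_top_of_finrank_eq_two {K L : Type*} [Field K] [Field L] [Algebra K L]
    (hL : Module.finrank K L = 2) {s : L} (hs : s ∉ (algebraMap K L).range) : K⟮s⟯ = ⊤ := by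
  have := IntermediateField.isSimpleOrder_of_finrank_prime K L (hL ▸ Nat.prime_two)
  refine (eq_bot_or_eq_top K⟮s⟯).resolve_left fun h => hs ?_
  exact IntermediateField.mem_bot.mp (IntermediateField.adjoin_simple_eq_bot_iff.mp h)

theorem isAdjoinSqrtNegSeven_of_mul_ne_zero {L : Type*} [Field L] [Algebra GaussianField L]
    (hL : Module.finrank GaussianField L = 2) {x y : L} (hxy : x ^ 4 + y ^ 4 = 1)
    (h0 : x * y ≠ 0) : IsAdjoinSqrtNegSeven GaussianField L := by
  have : CharZero L := charZero_of_injective_algebraMap (algebraMap GaussianField L).injective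
  obtain ⟨t, e, ht, -, -, -, he, h⟩ :=
    FermatQuartic.exists_parameter_of_mul_ne_zero hL hxy h0
  have he' : e ∈ (algebraMap GaussianField L).fieldRange := by
    rcases sq_eq_one_iff.mp he with rfl | rfl
    · exact one_mem _
    · exact neg_mem (one_mem _)
  have hirr : ∀ n : ℕ, (n : L) ≠ 0 → (n : L) * t + e ∉ (algebraMap GaussianField L).range := by
    intro n hn hmem
    have h1 : (n : L) * t + e ∈ (algebraMap GaussianField L).fieldRange := hmem
    have h2 := div_mem (sub_mem h1 he') (natCast_mem _ n)
    rw [add_sub_cancel_right, mul_div_cancel_left₀ _ hn] at h2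
    exact ht h2
  rcases h with h | h
  · exact ⟨4 * t + e, h, adjoin_eq_top_of_finrank_eq_two hL
      (by exact_mod_cast hirr 4 (by norm_num))⟩
  · exact ⟨2 * t + e, h, adjoin_eq_top_of_finrank_eq_two hL
      (by exact_mod_cast hirr 2 (by norm_num))⟩

theorem mainTheorem5 (L : Type*) [Field L] [Algebra GaussianField L]
    (hL : Module.finrank GaussianField L = 2) :
    ((∃ x y : L, x ^ 4 + y ^ 4 = 1 ∧ x * y ≠ 0) → IsAdjoinSqrtNegSeven GaussianField L) ∧
    (¬ IsAdjoinSqrtNegSeven GaussianField L → quarticSolutions L = axisPoints L) ∧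
    (∀ s : L, s ^ 2 = -7 → quarticSolutions L = axisPoints L ∪ sqrtPoints L s) := by
  refine ⟨?_, fun h => ?_, fun s hs => ?_⟩
  · rintro ⟨x, y, hxy, h0⟩
    exact isAdjoinSqrtNegSeven_of_mul_ne_zero hL hxy h0
  · refine Set.Subset.antisymm ?_ axisPoints_subset
    rintro ⟨x, y⟩ (hxy : x ^ 4 + y ^ 4 = 1)
    refine mem_axisPoints_of_mul_eq_zero hxy ?_
    by_contra h0
    exact h (isAdjoinSqrtNegSeven_of_mul_ne_zero hL hxy h0)
  · refine Set.Subset.antisymm ?_ (Set.union_subset axisPoints_subset (sqrtPoints_subset hs))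
    rintro ⟨x, y⟩ (hxy : x ^ 4 + y ^ 4 = 1)
    by_cases h0 : x * y = 0
    · exact Or.inl (mem_axisPoints_of_mul_eq_zero hxy h0)
    · right
      obtain ⟨t, e, -, ht, hx, hy, he, h | h⟩ :=
        FermatQuartic.exists_parameter_of_mul_ne_zero hL hxy h0
      · exact mem_sqrtPoints_of_four_mul hs ht hx hy he h
      · exact mem_sqrtPoints_of_two_mul hs ht hx hy he h
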